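/- Let $C$ be a commutative $\mathbb{C}$-algebra and let $B$ be an Azumaya algebra over $C$ together with a $\mathbb{C}$-algebra map $\iota:\mathbb{C}^k\to B$. Let $\alpha=(d_1,\dots,d_k)$ be a tuple of positive integers, put $n=\sum_i d_i$, and suppose that $B$ has dimension vector $\alpha$: there are a faithfully flat étale extension $C\to D$ and an isomorphism of $D$-algebras $D\otimes_C B\cong M_n(D)$ under which $\iota$ becomes the diagonal embedding $(z_1,\dots,z_k)\mapsto\mathrm{diag}(z_1,\dots,z_1,\dots,z_k,\dots,z_k)$, with $z_i$ repeated $d_i$ times. Let $\mathrm{Out}_C(B)$ be the group of $C$-algebra automorphisms of $B$ modulo the inner ones $b\mapsto ubu^{-1}$ ($u\in B^\times$). Then $\varphi\mapsto (B_\varphi)^B=\{b\in B : b\,\varphi(x)=xb \text{ for all } x\in B\}$ induces an injective group homomorphism from $\mathrm{Out}_C(B)$ to the Picard group $\mathrm{Pic}(C)$; thus $\mathrm{Out}_C(B)\subseteq\mathrm{Pic}(C)$. Moreover, if $\psi$ is a $\mathbb{C}^k$-linear automorphism of $B$, that is, a $C$-algebra automorphism with $\psi(\iota(z))=\iota(z)$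 for all $z\in\mathbb{C}^k$, then the class of $\psi$ in $\mathrm{Out}_C(B)$ has finite order, and this order divides $\gcd(d_1,\dots,d_k)$. In particular, if $\gcd(d_1,\dots,d_k)=1$, then every such $\psi$ is inner. -/

import Mathlib

open scoped TensorProduct

namespace AzumayaDim

universe u v

section Out

variable (C : Type u) (B : Type v) [CommRing C] [Ring B] [Algebra C B]

/-- The homomorphism `Bˣ → Aut_C(B)` sending a unit `u` to the conjugation `b ↦ u * b * u⁻¹`. -/
def conjHom : Bˣ →* (B ≃ₐ[C] B) :=
  (MulSemiringAction.toAlgAut (ConjAct Bˣ) C B).comp ConjAct.toConjAct.toMonoidHom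

theorem conjHom_apply (w : Bˣ) (b : B) : conjHom C B w b = w * b * (w⁻¹ : Bˣ) := rfl

/-- The group of inner automorphisms of `B`. -/
def Inn : Subgroup (B ≃ₐ[C] B) := (conjHom C B).range

instance Inn_normal : (Inn C B).Normal := by
  refine ⟨?_⟩
  rintro _ ⟨w, rfl⟩ g
  refine ⟨Units.map (g : B →* B) w, ?_⟩
  ext b
  have hb : g (g⁻¹ b) = b := g.apply_symm_apply b
  simp only [AlgEquiv.mul_apply, conjHom_apply, map_mul, hb]
  rfl

/-- `Out_C(B)`: the `C`-linear algebra automorphisms of `B` modulo the inner ones. -/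
abbrev Out : Type v := (B ≃ₐ[C] B) ⧸ Inn C B

variable {C B}

/-- Let `B_φ` be the `B`-bimodule equal to `B` as a left module and with right action
`b · x := b * φ x`. This is the `C`-module `(B_φ)^B` of its central elements, that is, of the
`b` with `b · x = x * b` for all `x` in `B`. -/
def twistedCenter (φ : B ≃ₐ[C] B) : Submodule C B where
  carrier := {b | ∀ x, b * φ x = x * b}
  add_mem' {a b} ha hb x := by rw [add_mul, mul_add, ha x, hb x]
  zero_mem' x := by rw [zero_mul, mul_zero]
  smul_mem' c b hb x := by rw [Algebra.smul_mul_assoc, hb x, Algebra.mul_smul_comm]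

end Out

/-- The Azumaya algebra `B` over `C`, with the distinguished map `ι : ℂ^k → B`, has dimension
vector `d = (d_1, …, d_k)`: there are an étale cover `C → D` (étale and faithfully flat) and an
isomorphism of `D`-algebras from `D ⊗[C] B` to the algebra `M_n(D)`, `n = ∑ i, d_i`, whose
rows and columns are grouped into `k` blocks of sizes `d_1, …, d_k`, under which `ι` becomes the
diagonal embedding `z ↦ diag(z_1, …, z_1, …, z_k, …, z_k)` with `z_i` repeated `d_i` times. -/
def HasDimensionVector (C : Type u) (B : Type v) [CommRing C] [Algebra ℂ C] [Ring B]
    [Algebra C B] [Algebra ℂ B] [IsScalarTower ℂ C B] {k : ℕ} (d : Fin k → ℕ)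
    (ι : (Fin k → ℂ) →ₐ[ℂ] B) : Prop :=
  ∃ (D : Type u) (_ : CommRing D) (_ : Algebra C D),
    Algebra.Etale C D ∧ Module.FaithfullyFlat C D ∧
    ∃ f : (D ⊗[C] B) ≃ₐ[D] Matrix (Σ i, Fin (d i)) (Σ i, Fin (d i)) D,
      ∀ z : Fin k → ℂ, f (1 ⊗ₜ[C] ι z) =
        Matrix.diagonal (fun p => algebraMap C D (algebraMap ℂ C (z p.1)))

end AzumayaDim

/-!
An automorphism `φ` twists `B` into the bimodule `B_φ`. Since `B ⊗ Bᵐᵒᵖ ≃ End_C B` and `B` is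
finite projective, Morita theory gives `B * L_φ = B` for the central elements `L_φ = (B_φ)^B`. As
`L_φ * L_χ ⊆ L_{χφ}` and `L_1 = C`, Nakayama's lemma upgrades this to `L_φ * L_{φ⁻¹} = C`: each
`L_φ` is an invertible submodule of `B`, and it is free exactly when it is generated by a unit,
which makes `φ` inner.

The inverse of `L_φ` also shows that the determinant is invariant under automorphisms of matrix
algebras: `a * φ x = x * a` gives `det a * det (φ x) = det x * det a`, and the `det a`, `a ∈ L_φ`,
generate the unit ideal. By faithfully flat descent a split form of a matrix algebra therefore has
a reduced norm with values in `C`. If `ψ` fixes an idempotent `e` of rank `r`, then `L_ψ` commutes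
with `e`, and the reduced norm of `e * a + (1 - e)`, homogeneous of degree `r` in `a ∈ L_ψ`,
trivializes the `r`-th power of `L_ψ`.
-/

namespace AzumayaDim

open Module Submodule

section FiniteProjective

theorem linearMap_induction_smulRight {R M N : Type*} [CommSemiring R] [AddCommMonoid M]
    [Module R M] [Module.Finite R M] [Module.Projective R M] [AddCommMonoid N] [Module R N]
    {P : (M →ₗ[R] N) → Prop} (smulRight : ∀ (l : Dual R M) (n : N), P (l.smulRight n))
    (add : ∀ g h, P g → P h → P (g + h)) (g : M →ₗ[R] N) : P g := by
  obtain ⟨t, rfl⟩ := (dualTensorHomEquiv R M N).surjective g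
  induction t with
  | zero => simpa using smulRight 0 0
  | add x y hx hy => simpa only [map_add] using add _ _ hx hy
  | tmul l n => exact smulRight l n

variable {C : Type*} [CommRing C]

theorem ideal_eq_top_of_top_le_smul_top {M : Type*} [AddCommGroup M] [Module C M]
    [FaithfulSMul C M] [Module.Finite C M] {I : Ideal C} (h : (⊤ : Submodule C M) ≤ I • ⊤) :
    I = ⊤ := by
  obtain ⟨r, hr, hr0⟩ :=
    exists_sub_one_mem_and_smul_eq_zero_of_fg_of_le_smul I ⊤ Module.Finite.fg_top h
  have hr_zero : r = 0 := FaithfulSMul.eq_of_smul_eq_smul (α := M) fun m => by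
    rw [hr0 m mem_top, zero_smul]
  rw [hr_zero, zero_sub, neg_mem_iff] at hr
  exact (Ideal.eq_top_iff_one I).mpr hr

variable {B : Type*} [Ring B] [Algebra C B] [FaithfulSMul C B] [Module.Finite C B]

theorem eq_one_of_top_mul_eq_top {J : Submodule C B} (hJ : J ≤ 1) (h : ⊤ * J = ⊤) : J = 1 := by
  have hI : J.comap (Algebra.linearMap C B) = ⊤ := by
    refine ideal_eq_top_of_top_le_smul_top (h.ge.trans (Submodule.mul_le.mpr fun b _ j hj => ?_))
    obtain ⟨c, rfl⟩ := mem_one.mp (hJ hj)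
    rw [← Algebra.commutes, ← Algebra.smul_def]
    exact smul_mem_smul hj mem_top
  refine le_antisymm hJ (one_le.mpr ?_)
  simpa using (Ideal.eq_top_iff_one _).mp hI

variable (C B) in
theorem exists_dual_apply_one_eq_one [Module.Projective C B] : ∃ l : Dual C B, l 1 = 1 := by
  let I : Ideal C := LinearMap.range (LinearMap.applyₗ (R := C) (M₂ := C) (1 : B))
  have hmul (m : B) (g : Module.End C B) : g 1 * m ∈ I • (⊤ : Submodule C B) := by
    induction g using linearMap_induction_smulRight with
    | smulRight l b =>
      rw [LinearMap.smulRight_apply, smul_mul_assoc]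
      exact smul_mem_smul ⟨l, rfl⟩ mem_top
    | add g h hg hh => simpa only [LinearMap.add_apply, add_mul] using add_mem hg hh
  have hI : I = ⊤ := ideal_eq_top_of_top_le_smul_top (M := B) fun m _ => by
    simpa using hmul m 1
  exact (Ideal.eq_top_iff_one I).mp hI

end FiniteProjective

section TwistedCenter

variable {C B : Type*} [CommRing C] [Ring B] [Algebra C B] {φ χ : B ≃ₐ[C] B} {a b u v : B}

theorem mul_mem_twistedCenter (ha : a ∈ twistedCenter φ) (hb : b ∈ twistedCenter χ) :
    a * b ∈ twistedCenter (χ * φ) := fun x => by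
  rw [AlgEquiv.mul_apply, mul_assoc, hb (φ x), ← mul_assoc, ha x, mul_assoc]

theorem twistedCenter_mul_le (φ χ : B ≃ₐ[C] B) :
    twistedCenter φ * twistedCenter χ ≤ twistedCenter (χ * φ) :=
  Submodule.mul_le.mpr fun _ ha _ hb => mul_mem_twistedCenter ha hb

theorem pow_mem_twistedCenter (ha : a ∈ twistedCenter φ) (n : ℕ) :
    a ^ n ∈ twistedCenter (φ ^ n) := by
  induction n with
  | zero => intro x; simp
  | succ n ih => rw [pow_succ', pow_succ]; exact mul_mem_twistedCenter ih ha

theorem commute_of_mem_twistedCenter (ha : a ∈ twistedCenter φ) {x : B} (hx : φ x = x) :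
    Commute x a :=
  (ha x).symm.trans (by rw [hx])

theorem mem_Inn_of_isUnit_mem_twistedCenter (hu : IsUnit u) (h : u ∈ twistedCenter φ) :
    φ ∈ Inn C B := by
  obtain ⟨u, rfl⟩ := hu
  refine ⟨u⁻¹, AlgEquiv.ext fun x => ?_⟩
  rw [conjHom_apply, mul_assoc, inv_inv, ← h x, Units.inv_mul_cancel_left]

theorem mem_Inn_of_mul_eq_one (hu : u ∈ twistedCenter φ) (hv : v ∈ twistedCenter φ⁻¹)
    (huv : u * v = 1) : φ ∈ Inn C B := by
  have hcomm : Commute u (v * u) := commute_of_mem_twistedCenter (mul_mem_twistedCenter hv hu)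
    (φ.apply_symm_apply u)
  have hvu : v * u = 1 := calc
    v * u = v * u * u * v := by rw [mul_assoc (v * u), huv, mul_one]
    _ = u * v * (u * v) := by rw [← hcomm.eq, mul_assoc u, mul_assoc u, mul_assoc v]
    _ = 1 := by rw [huv, mul_one]
  exact mem_Inn_of_isUnit_mem_twistedCenter ⟨⟨u, v, huv, hvu⟩, rfl⟩ hu

end TwistedCenter

section Azumaya

variable {C B : Type*} [CommRing C] [Ring B] [Algebra C B] [IsAzumaya C B]

variable (C B) in
/-- The isomorphism `B ⊗ Bᵐᵒᵖ ≃ End_C B` that defines an Azumaya algebra. -/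
noncomputable def mulLeftRightEquiv : B ⊗[C] Bᵐᵒᵖ ≃ₐ[C] Module.End C B :=
  AlgEquiv.ofBijective _ (IsAzumaya.AlgHom.mulLeftRight_bij C B)

/-- The `B ⊗ Bᵐᵒᵖ`-module structure of the bimodule `B_φ`, whose right action is
`b · x := b * φ x`, transported to an action of `End_C B` along `mulLeftRightEquiv`. -/
noncomputable def twistedAction (φ : B ≃ₐ[C] B) : Module.End C B →ₐ[C] Module.End C B :=
  ((AlgHom.mulLeftRight C B).comp (Algebra.TensorProduct.map (AlgHom.id C B) φ.toAlgHom.op)).comp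
    (mulLeftRightEquiv C B).symm.toAlgHom

theorem twistedAction_mulLeftRight (φ : B ≃ₐ[C] B) (t : B ⊗[C] Bᵐᵒᵖ) :
    twistedAction φ (AlgHom.mulLeftRight C B t) =
      AlgHom.mulLeftRight C B (Algebra.TensorProduct.map (AlgHom.id C B) φ.toAlgHom.op t) :=
  congrArg (fun s => AlgHom.mulLeftRight C B (Algebra.TensorProduct.map (AlgHom.id C B)
    φ.toAlgHom.op s)) ((mulLeftRightEquiv C B).symm_apply_apply t)

theorem twistedAction_mulLeft (φ : B ≃ₐ[C] B) (x : B) :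
    twistedAction φ (LinearMap.mulLeft C x) = LinearMap.mulLeft C x := by
  have h : LinearMap.mulLeft C x = AlgHom.mulLeftRight C B (x ⊗ₜ 1) := by ext; simp
  rw [h, twistedAction_mulLeftRight]
  simp

theorem twistedAction_mulRight (φ : B ≃ₐ[C] B) (x : B) :
    twistedAction φ (LinearMap.mulRight C x) = LinearMap.mulRight C (φ x) := by
  have h (y : B) : LinearMap.mulRight C y = AlgHom.mulLeftRight C B (1 ⊗ₜ .op y) := by ext; simp
  rw [h, h, twistedAction_mulLeftRight]
  simp

theorem twistedAction_smulRight_one_mem (φ : B ≃ₐ[C] B) (l : Dual C B) (m : B) :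
    twistedAction φ (l.smulRight 1) m ∈ twistedCenter φ := fun x => by
  have h : LinearMap.mulRight C x * l.smulRight 1 = LinearMap.mulLeft C x * l.smulRight 1 := by
    ext; simp
  have h' := congrArg (fun g => twistedAction φ g m) h
  simpa [twistedAction_mulLeft, twistedAction_mulRight] using h'

theorem top_mul_twistedCenter (φ : B ≃ₐ[C] B) : ⊤ * twistedCenter φ = ⊤ := by
  refine top_unique fun m _ => ?_
  suffices h : ∀ g, twistedAction φ g m ∈ ⊤ * twistedCenter φ by simpa using h 1
  intro g
  induction g using linearMap_induction_smulRight with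
  | smulRight l b =>
    have h : l.smulRight b = LinearMap.mulLeft C b * l.smulRight 1 := by ext; simp
    rw [h, map_mul, twistedAction_mulLeft]
    exact mul_mem_mul mem_top (twistedAction_smulRight_one_mem φ l m)
  | add g h hg hh => simpa only [map_add, LinearMap.add_apply] using add_mem hg hh

theorem end_apply_eq_apply_one_mul {z : B} (hz : z ∈ twistedCenter (1 : B ≃ₐ[C] B))
    (g : Module.End C B) : g z = g 1 * z := by
  obtain ⟨t, rfl⟩ := (mulLeftRightEquiv C B).surjective g
  induction t with
  | zero => simp
  | add s t hs ht => simp only [map_add, LinearMap.add_apply, hs, ht, add_mul]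
  | tmul x y =>
    have hzy : z * y.unop = y.unop * z := hz y.unop
    simp [mulLeftRightEquiv, mul_assoc, hzy]

theorem twistedCenter_one : twistedCenter (1 : B ≃ₐ[C] B) = 1 := by
  refine le_antisymm (fun z hz => ?_) (one_le.mpr fun x => by simp)
  obtain ⟨l, hl⟩ := exists_dual_apply_one_eq_one C B
  have h := end_apply_eq_apply_one_mul hz (l.smulRight 1)
  simp only [LinearMap.smulRight_apply, hl, one_smul, one_mul] at h
  exact mem_one.mpr ⟨l z, by rw [Algebra.algebraMap_eq_smul_one, h]⟩

theorem twistedCenter_mul_twistedCenter_eq_one {φ χ : B ≃ₐ[C] B} (h : χ * φ = 1) :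
    twistedCenter φ * twistedCenter χ = 1 := by
  refine eq_one_of_top_mul_eq_top ((twistedCenter_mul_le φ χ).trans ?_) ?_
  · rw [h, twistedCenter_one]
  · rw [← mul_assoc, top_mul_twistedCenter, top_mul_twistedCenter]

theorem twistedCenter_mul (φ χ : B ≃ₐ[C] B) :
    twistedCenter φ * twistedCenter χ = twistedCenter (χ * φ) := by
  refine le_antisymm (twistedCenter_mul_le φ χ) ?_
  calc twistedCenter (χ * φ)
      = twistedCenter φ * (twistedCenter φ⁻¹ * twistedCenter (χ * φ)) := by
        rw [← mul_assoc, twistedCenter_mul_twistedCenter_eq_one (inv_mul_cancel φ), one_mul]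
    _ ≤ twistedCenter φ * twistedCenter (χ * φ * φ⁻¹) :=
        mul_le_mul' le_rfl (twistedCenter_mul_le _ _)
    _ = twistedCenter φ * twistedCenter χ := by rw [mul_inv_cancel_right]

theorem twistedCenter_conjHom (u : Bˣ) :
    twistedCenter (conjHom C B u) = span C {((u⁻¹ : Bˣ) : B)} := by
  have hu : ((u⁻¹ : Bˣ) : B) ∈ twistedCenter (conjHom C B u) := fun x => by
    rw [conjHom_apply, ← mul_assoc, ← mul_assoc, Units.inv_mul, one_mul]
  have hu' : (u : B) ∈ twistedCenter (conjHom C B u)⁻¹ := fun x => by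
    rw [← map_inv, conjHom_apply, inv_inv, ← mul_assoc, ← mul_assoc, Units.mul_inv, one_mul]
  refine le_antisymm (fun b hb => ?_) ((span_singleton_le_iff_mem _ _).mpr hu)
  have hbu : b * u ∈ twistedCenter (1 : B ≃ₐ[C] B) := by
    simpa using mul_mem_twistedCenter hb hu'
  obtain ⟨c, hc⟩ := mem_one.mp (twistedCenter_one (C := C) (B := B) ▸ hbu)
  exact mem_span_singleton.mpr ⟨c, by rw [Algebra.smul_def, hc, Units.mul_inv_cancel_right]⟩

/-- `twistedCenter φ` as an invertible submodule of `B`. -/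
def twistedCenterUnit (φ : B ≃ₐ[C] B) : (Submodule C B)ˣ where
  val := twistedCenter φ
  inv := twistedCenter φ⁻¹
  val_inv := twistedCenter_mul_twistedCenter_eq_one (inv_mul_cancel φ)
  inv_val := twistedCenter_mul_twistedCenter_eq_one (mul_inv_cancel φ)

variable (C B) in
/-- The homomorphism `φ ↦ twistedCenter φ` from automorphisms to the Picard group. The submodules
multiply in the opposite order, which is immaterial in the commutative group `Pic C`. -/
noncomputable def autToPic : (B ≃ₐ[C] B) →* CommRing.Pic C where
  toFun φ := unitsToPic C B (twistedCenterUnit φ)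
  map_one' := by
    rw [show twistedCenterUnit (1 : B ≃ₐ[C] B) = 1 from Units.ext twistedCenter_one, map_one]
  map_mul' φ χ := by
    rw [mul_comm, ← map_mul]
    exact congrArg _ (Units.ext (twistedCenter_mul χ φ).symm)

theorem ker_autToPic : (autToPic C B).ker = Inn C B := by
  ext φ
  change twistedCenterUnit φ ∈ (unitsToPic C B).ker ↔ _
  rw [ker_unitsToPic]
  constructor
  · rintro ⟨u, hu⟩
    have hspan : span C {(u : B)} = twistedCenter φ := congrArg Units.val hu
    exact mem_Inn_of_isUnit_mem_twistedCenter u.isUnit (hspan ▸ mem_span_singleton_self _)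
  · rintro ⟨u, rfl⟩
    exact ⟨u⁻¹, Units.ext (twistedCenter_conjHom u).symm⟩

variable (C B) in
/-- The homomorphism from outer automorphisms to the Picard group induced by
`φ ↦ twistedCenter φ`. -/
noncomputable def outToPic : Out C B →* CommRing.Pic C :=
  QuotientGroup.lift (Inn C B) (autToPic C B) ker_autToPic.ge

theorem outToPic_injective : Function.Injective (outToPic C B) :=
  (QuotientGroup.injective_lift_iff _ _ ker_autToPic.ge).mpr ker_autToPic.symm

/-- The class of `φ` under `outToPic` is represented by `twistedCenter φ`. -/
noncomputable def outToPicEquiv (φ : B ≃ₐ[C] B) :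
    (outToPic C B (QuotientGroup.mk φ) : CommRing.Pic C) ≃ₗ[C] twistedCenter φ :=
  unitsToPicEquiv (twistedCenterUnit φ)

theorem exists_algebraMap_eq_mul {φ : B ≃ₐ[C] B} {a b : B} (ha : a ∈ twistedCenter φ)
    (hb : b ∈ twistedCenter φ⁻¹) : ∃ c, algebraMap C B c = a * b :=
  mem_one.mp (twistedCenter_mul_twistedCenter_eq_one (inv_mul_cancel φ) ▸ mul_mem_mul ha hb)

theorem span_twistedCenter_mul_inv_eq_top (φ : B ≃ₐ[C] B) :
    Ideal.span {c : C | ∃ (a : twistedCenter φ) (b : twistedCenter φ⁻¹),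
      (a * b : B) = algebraMap C B c} = ⊤ := by
  set I := Ideal.span {c : C | ∃ (a : twistedCenter φ) (b : twistedCenter φ⁻¹),
    (a * b : B) = algebraMap C B c}
  have hle : twistedCenter φ * twistedCenter φ⁻¹ ≤ Submodule.map (Algebra.linearMap C B) I :=
    Submodule.mul_le.mpr fun a ha b hb => by
      obtain ⟨c, hc⟩ := exists_algebraMap_eq_mul ha hb
      exact ⟨c, Ideal.subset_span ⟨⟨a, ha⟩, ⟨b, hb⟩, hc.symm⟩, hc⟩
  obtain ⟨c, hcI, hc⟩ := (twistedCenter_mul_twistedCenter_eq_one (inv_mul_cancel φ)).ge.trans hle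
    (one_le.mp le_rfl)
  have hc_one : c = 1 := FaithfulSMul.algebraMap_injective C B (by simpa using hc)
  exact (Ideal.eq_top_iff_one I).mpr (hc_one ▸ hcI)

theorem exists_sum_mul_pow_eq_one (φ : B ≃ₐ[C] B) (n : ℕ) :
    ∃ (s : ℕ) (a : Fin s → twistedCenter φ) (b : Fin s → twistedCenter φ⁻¹) (r c : Fin s → C),
      (∀ i, (a i * b i : B) = algebraMap C B (c i)) ∧ ∑ i, r i * c i ^ n = 1 := by
  have hone := (Ideal.eq_top_iff_one _).mp
    (Ideal.span_pow_eq_top _ (span_twistedCenter_mul_inv_eq_top φ) n)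
  obtain ⟨s, r, g, hsum⟩ := mem_span_set'.mp hone
  choose c hc hcg using fun i => (g i).2
  choose a b hab using hc
  exact ⟨s, a, b, r, c, hab, by simpa only [hcg, smul_eq_mul] using hsum⟩

end Azumaya

section Torsion

theorem pow_mul_pow_eq_algebraMap_pow {R A : Type*} [CommSemiring R] [Semiring A] [Algebra R A]
    {a b : A} {c : R} (h : a * b = algebraMap R A c) (n : ℕ) :
    a ^ n * b ^ n = algebraMap R A c ^ n := by
  induction n with
  | zero => simp
  | succ n ih =>
    rw [pow_succ a, pow_succ' b, mul_assoc, ← mul_assoc a b, h, Algebra.left_comm, ih, pow_succ']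

variable {C B : Type*} [CommRing C] [Ring B] [Algebra C B] [IsAzumaya C B]

theorem pow_mem_Inn_of_norm (φ : B ≃ₐ[C] B) (n : ℕ) (N : B → C)
    (hN : ∀ a ∈ twistedCenter φ, ∀ b ∈ twistedCenter φ⁻¹, ∀ c : C,
      a * b = algebraMap C B c → N a * N b = c ^ n) : φ ^ n ∈ Inn C B := by
  obtain ⟨s, a, b, r, c, hab, hsum⟩ := exists_sum_mul_pow_eq_one φ n
  have hNab : ∑ i, r i * (N (a i) * N (b i)) = 1 := by
    rw [← hsum]
    exact Finset.sum_congr rfl fun i _ => by rw [hN _ (a i).2 _ (b i).2 _ (hab i)]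
  have hpow (i j) : (a i : B) ^ n * (b j : B) ^ n = algebraMap C B (N (a i) * N (b j)) := by
    obtain ⟨e, he⟩ := exists_algebraMap_eq_mul (a i).2 (b j).2
    rw [hN _ (a i).2 _ (b j).2 e he.symm, map_pow, pow_mul_pow_eq_algebraMap_pow he.symm]
  -- `u` is the preimage of `1` under the isomorphism `a ^ n ↦ N a` from the `n`-th power of
  -- `twistedCenter φ` to `C`, and `v` is the corresponding element for `φ⁻¹`.
  let u : B := ∑ i, (r i * N (b i)) • (a i : B) ^ n
  let v : B := ∑ i, (r i * N (a i)) • (b i : B) ^ n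
  have hu : u ∈ twistedCenter (φ ^ n) :=
    sum_mem fun i _ => smul_mem _ _ (pow_mem_twistedCenter (a i).2 n)
  have hv : v ∈ twistedCenter (φ ^ n)⁻¹ :=
    inv_pow φ n ▸ sum_mem fun i _ => smul_mem _ _ (pow_mem_twistedCenter (b i).2 n)
  have hterm (i j) : (r i * N (b i)) • (a i : B) ^ n * (r j * N (a j)) • (b j : B) ^ n =
      algebraMap C B (r i * (N (a i) * N (b i)) * (r j * (N (a j) * N (b j)))) := by
    rw [smul_mul_smul_comm, hpow, Algebra.smul_def, ← map_mul]
    congr 1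
    ring
  have huv : u * v = 1 := by
    simp only [u, v, Finset.sum_mul_sum, hterm, ← map_sum]
    rw [← Finset.sum_mul_sum, hNab, one_mul, map_one]
  exact mem_Inn_of_mul_eq_one hu hv huv

end Torsion

section ReducedNorm

variable {m : Type*} [Fintype m] [DecidableEq m]

theorem det_algEquiv_apply {R : Type*} [CommRing R] (θ : Matrix m m R ≃ₐ[R] Matrix m m R)
    (x : Matrix m m R) : (θ x).det = x.det := by
  cases isEmpty_or_nonempty m
  · simp only [Matrix.det_isEmpty]
  have := IsAzumaya.matrix R m
  obtain ⟨s, a, b, r, c, hab, hsum⟩ := exists_sum_mul_pow_eq_one θ (Fintype.card m)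
  have ha (i) : (a i : Matrix m m R).det * ((θ x).det - x.det) = 0 := by
    rw [mul_sub, ← Matrix.det_mul, (a i).2 x, Matrix.det_mul, mul_comm, sub_self]
  have hc (i) : c i ^ Fintype.card m = (b i : Matrix m m R).det * (a i : Matrix m m R).det := by
    rw [mul_comm, ← Matrix.det_mul, hab, Algebra.algebraMap_eq_smul_one, Matrix.det_smul,
      Matrix.det_one, mul_one]
  refine sub_eq_zero.mp ?_
  rw [← one_mul ((θ x).det - x.det), ← hsum, Finset.sum_mul]
  exact Finset.sum_eq_zero fun i _ => by rw [hc, mul_assoc, mul_assoc, ha, mul_zero, mul_zero]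

variable {C B D : Type*} [CommRing C] [Ring B] [Algebra C B] [CommRing D] [Algebra C D]

variable (m D) in
/-- `matrixEquivTensor` as an isomorphism of algebras over `E` instead of over `D`. -/
noncomputable def tensorMatrixEquiv (E : Type*) [CommRing E] [Algebra D E] :
    E ⊗[D] Matrix m m D ≃ₐ[E] Matrix m m E :=
  AlgEquiv.ofRingEquiv (f := (matrixEquivTensor m D E).symm.toRingEquiv) fun e => by
    rw [Algebra.TensorProduct.algebraMap_apply]
    ext i j
    simp [Matrix.algebraMap_matrix_apply, Matrix.one_apply]

/-- The associativity isomorphism `E ⊗[C] B ≃ E ⊗[D] (D ⊗[C] B)` of algebras, for `B` not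
necessarily commutative. -/
noncomputable def cancelBaseChangeSymm (C B D E : Type*) [CommRing C] [Ring B] [Algebra C B]
    [CommRing D] [Algebra C D] [CommRing E] [Algebra C E] [Algebra D E] [IsScalarTower C D E] :
    E ⊗[C] B ≃ₐ[E] E ⊗[D] (D ⊗[C] B) :=
  Algebra.TensorProduct.algEquivOfLinearEquivTensorProduct
    (TensorProduct.AlgebraTensorModule.cancelBaseChange C D E E B).symm (by simp)
    (by simp [Algebra.TensorProduct.one_def])

theorem cancelBaseChangeSymm_tmul {E : Type*} [CommRing E] [Algebra C E] [Algebra D E]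
    [IsScalarTower C D E] (e : E) (b : B) :
    cancelBaseChangeSymm C B D E (e ⊗ₜ b) = e ⊗ₜ (1 ⊗ₜ b) :=
  rfl

/-- The splitting over a `D`-algebra `E` induced by a splitting over `D`. -/
noncomputable def splittingBaseChange (f : D ⊗[C] B ≃ₐ[D] Matrix m m D) (E : Type*) [CommRing E]
    [Algebra C E] [Algebra D E] [IsScalarTower C D E] : E ⊗[C] B ≃ₐ[E] Matrix m m E :=
  (cancelBaseChangeSymm C B D E).trans <|
    (Algebra.TensorProduct.congr AlgEquiv.refl f).trans (tensorMatrixEquiv m D E)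

theorem splittingBaseChange_one_tmul (f : D ⊗[C] B ≃ₐ[D] Matrix m m D) (E : Type*) [CommRing E]
    [Algebra C E] [Algebra D E] [IsScalarTower C D E] (b : B) :
    splittingBaseChange f E (1 ⊗ₜ b) = (f (1 ⊗ₜ b)).map (algebraMap D E) := by
  simp [splittingBaseChange, tensorMatrixEquiv, cancelBaseChangeSymm_tmul]

theorem algHom_det_splitting_eq {E : Type*} [CommRing E] [Algebra C E]
    (f : D ⊗[C] B ≃ₐ[D] Matrix m m D) (σ τ : D →ₐ[C] E) (b : B) :
    σ (f (1 ⊗ₜ b)).det = τ (f (1 ⊗ₜ b)).det := by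
  have hsplit (ρ : D →ₐ[C] E) : ∃ g : E ⊗[C] B ≃ₐ[E] Matrix m m E,
      (g (1 ⊗ₜ b)).det = ρ (f (1 ⊗ₜ b)).det := by
    let _ := ρ.toAlgebra
    have : IsScalarTower C D E := .of_algebraMap_eq fun c => (ρ.commutes c).symm
    exact ⟨splittingBaseChange f E, by
      rw [splittingBaseChange_one_tmul]; exact ((algebraMap D E).map_det _).symm⟩
  obtain ⟨g, hg⟩ := hsplit σ
  obtain ⟨h, hh⟩ := hsplit τ
  rw [← hg, ← hh]
  simpa using (det_algEquiv_apply (g.symm.trans h) (g (1 ⊗ₜ b))).symm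

variable [Module.FaithfullyFlat C D]

theorem det_splitting_mem_range (f : D ⊗[C] B ≃ₐ[D] Matrix m m D) (b : B) :
    (f (1 ⊗ₜ b)).det ∈ Set.range (algebraMap C D) := by
  rw [← (Algebra.IsEffective.of_faithfullyFlat C D).eqLocus_includeLeft_includeRight]
  exact algHom_det_splitting_eq f (Algebra.TensorProduct.includeLeft : D →ₐ[C] D ⊗[C] D)
    Algebra.TensorProduct.includeRight b

/-- The reduced norm of an algebra split by a faithfully flat extension `D` of `C`: the
determinant in the splitting, which descends to `C`. -/
noncomputable def reducedNorm (f : D ⊗[C] B ≃ₐ[D] Matrix m m D) (b : B) : C :=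
  (det_splitting_mem_range f b).choose

theorem algebraMap_reducedNorm (f : D ⊗[C] B ≃ₐ[D] Matrix m m D) (b : B) :
    algebraMap C D (reducedNorm f b) = (f (1 ⊗ₜ b)).det :=
  (det_splitting_mem_range f b).choose_spec

theorem reducedNorm_mul (f : D ⊗[C] B ≃ₐ[D] Matrix m m D) (a b : B) :
    reducedNorm f (a * b) = reducedNorm f a * reducedNorm f b := by
  apply FaithfulSMul.algebraMap_injective C D
  rw [map_mul, algebraMap_reducedNorm, algebraMap_reducedNorm, algebraMap_reducedNorm,
    ← Matrix.det_mul, ← map_mul, Algebra.TensorProduct.tmul_mul_tmul, mul_one]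

end ReducedNorm

section Idempotent

theorem mul_add_one_sub_mul_mul_add_one_sub {A : Type*} [Ring A] {e a : A}
    (he : IsIdempotentElem e) (ha : Commute e a) (b : A) :
    (e * a + (1 - e)) * (e * b + (1 - e)) = e * (a * b) + (1 - e) := by
  have hcorner : e * a * (e * b) = e * (a * b) := by
    rw [ha.eq, mul_assoc, ← mul_assoc e, he.eq, ← mul_assoc, ← ha.eq, mul_assoc]
  have hleft : e * a * (1 - e) = 0 := by rw [ha.eq, mul_assoc, he.mul_one_sub_self, mul_zero]
  have hright : (1 - e) * (e * b) = 0 := by rw [← mul_assoc, he.one_sub_mul_self, zero_mul]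
  rw [add_mul, mul_add, mul_add, hcorner, hleft, hright, he.one_sub.eq, add_zero, zero_add]

theorem det_smul_add_one_sub_of_eq_diagonal {R κ : Type*} [CommRing R] [Fintype κ]
    [DecidableEq κ] {d : κ → ℕ} {i : κ} {e : Matrix (Σ j, Fin (d j)) (Σ j, Fin (d j)) R}
    (he : e = Matrix.diagonal fun p => if p.1 = i then 1 else 0) (c : R) :
    (c • e + (1 - e)).det = c ^ d i := by
  have hdiag : c • e + (1 - e) = Matrix.diagonal fun p => if p.1 = i then c else 1 := by
    rw [he, ← Matrix.diagonal_one, ← Matrix.diagonal_smul, Matrix.diagonal_sub,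
      Matrix.diagonal_add]
    congr 1
    ext p
    by_cases h : p.1 = i <;> simp [h]
  rw [hdiag, Matrix.det_diagonal, Fintype.prod_sigma, Finset.prod_eq_single i]
  · simp
  · intro j _ hj
    simp [hj]
  · simp

variable {C B D m : Type*} [CommRing C] [Ring B] [Algebra C B] [IsAzumaya C B] [CommRing D]
  [Algebra C D] [Module.FaithfullyFlat C D] [Fintype m] [DecidableEq m]

theorem pow_mem_Inn_of_fixes_idempotent (f : D ⊗[C] B ≃ₐ[D] Matrix m m D) {e : B}
    (he : IsIdempotentElem e) {r : ℕ}
    (hr : ∀ c : D, (c • f (1 ⊗ₜ e) + (1 - f (1 ⊗ₜ e))).det = c ^ r) {ψ : B ≃ₐ[C] B}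
    (hψ : ψ e = e) : ψ ^ r ∈ Inn C B := by
  refine pow_mem_Inn_of_norm ψ r (fun a => reducedNorm f (e * a + (1 - e)))
    fun a ha b _ c hab => FaithfulSMul.algebraMap_injective C D ?_
  have htensor : (1 : D) ⊗ₜ[C] (e * algebraMap C B c + (1 - e)) =
      algebraMap C D c • (1 ⊗ₜ e) + (1 - 1 ⊗ₜ e) := by
    rw [← Algebra.commutes, ← Algebra.smul_def, TensorProduct.tmul_add, TensorProduct.tmul_sub,
      TensorProduct.tmul_smul, algebraMap_smul, Algebra.TensorProduct.one_def]
  rw [← reducedNorm_mul,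
    mul_add_one_sub_mul_mul_add_one_sub he (commute_of_mem_twistedCenter ha hψ), hab,
    algebraMap_reducedNorm, htensor, map_add, map_sub, map_smul, map_one, hr, map_pow]

end Idempotent

section Main

variable {C B D R κ : Type*} [CommRing C] [Ring B] [Algebra C B] [IsAzumaya C B] [CommRing D]
  [Algebra C D] [Module.FaithfullyFlat C D] [CommSemiring R] [Algebra R C] [Fintype κ]
  [DecidableEq κ]

theorem orderOf_dvd_gcd_of_fixes (d : κ → ℕ) (ι : (κ → R) →+* B)
    (f : D ⊗[C] B ≃ₐ[D] Matrix (Σ i, Fin (d i)) (Σ i, Fin (d i)) D)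
    (hf : ∀ z, f (1 ⊗ₜ ι z) =
      Matrix.diagonal fun p => algebraMap C D (algebraMap R C (z p.1)))
    {ψ : B ≃ₐ[C] B} (hψ : ∀ z, ψ (ι z) = ι z) :
    orderOf (QuotientGroup.mk ψ : Out C B) ∣ Finset.univ.gcd d := by
  refine Finset.dvd_gcd fun i _ => orderOf_dvd_of_pow_eq_one ?_
  rw [← QuotientGroup.mk_pow, QuotientGroup.eq_one_iff]
  have he : IsIdempotentElem (ι (Pi.single i 1)) := by
    rw [IsIdempotentElem, ← map_mul, ← Pi.single_mul, mul_one]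
  have hfe : f (1 ⊗ₜ ι (Pi.single i 1)) =
      Matrix.diagonal fun p => if p.1 = i then 1 else 0 := by
    simp only [hf, Pi.single_apply, apply_ite (algebraMap R C), apply_ite (algebraMap C D), map_one,
      map_zero]
  exact pow_mem_Inn_of_fixes_idempotent f he
    (det_smul_add_one_sub_of_eq_diagonal hfe) (hψ _)

end Main

end AzumayaDim

theorem mainTheorem6_general {C B D R κ : Type*} [CommRing C] [Ring B] [Algebra C B]
    [IsAzumaya C B] [CommRing D] [Algebra C D] [Module.FaithfullyFlat C D] [CommSemiring R]
    [Algebra R C] [Fintype κ] [DecidableEq κ] (d : κ → ℕ) (ι : (κ → R) →+* B)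
    (f : D ⊗[C] B ≃ₐ[D] Matrix (Σ i, Fin (d i)) (Σ i, Fin (d i)) D)
    (hf : ∀ z : κ → R, f (1 ⊗ₜ[C] ι z) =
      Matrix.diagonal (fun p => algebraMap C D (algebraMap R C (z p.1)))) :
    (∃ Φ : AzumayaDim.Out C B →* CommRing.Pic C, Function.Injective Φ ∧
      ∀ φ : B ≃ₐ[C] B, Nonempty
        ((Φ (QuotientGroup.mk φ) : CommRing.Pic C) ≃ₗ[C] AzumayaDim.twistedCenter φ)) ∧
    ∀ ψ : B ≃ₐ[C] B, (∀ z : κ → R, ψ (ι z) = ι z) →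
      orderOf (QuotientGroup.mk ψ : AzumayaDim.Out C B) ∣ Finset.univ.gcd d ∧
      (Finset.univ.gcd d = 1 → ∃ w : Bˣ, ∀ b : B, ψ b = w * b * (w⁻¹ : Bˣ)) := by
  refine ⟨⟨AzumayaDim.outToPic C B, AzumayaDim.outToPic_injective,
    fun φ => ⟨AzumayaDim.outToPicEquiv φ⟩⟩, fun ψ hψ => ?_⟩
  have hdvd := AzumayaDim.orderOf_dvd_gcd_of_fixes d ι f hf hψ
  refine ⟨hdvd, fun hgcd => ?_⟩
  rw [hgcd, Nat.dvd_one, orderOf_eq_one_iff, QuotientGroup.eq_one_iff] at hdvd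
  obtain ⟨w, rfl⟩ := hdvd
  exact ⟨w, AzumayaDim.conjHom_apply C B w⟩

theorem mainTheorem6 {C : Type*} {B : Type*} [CommRing C] [Algebra ℂ C] [Ring B] [Algebra C B]
    [Algebra ℂ B] [IsScalarTower ℂ C B] [IsAzumaya C B] {k : ℕ} (d : Fin k → ℕ)
    (hd : ∀ i, 0 < d i) (ι : (Fin k → ℂ) →ₐ[ℂ] B)
    (hB : AzumayaDim.HasDimensionVector C B d ι) :
    (∃ Φ : AzumayaDim.Out C B →* CommRing.Pic C, Function.Injective Φ ∧
      ∀ φ : B ≃ₐ[C] B, Nonempty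
        ((Φ (QuotientGroup.mk φ) : CommRing.Pic C) ≃ₗ[C] AzumayaDim.twistedCenter φ)) ∧
    ∀ ψ : B ≃ₐ[C] B, (∀ z : Fin k → ℂ, ψ (ι z) = ι z) →
      orderOf (QuotientGroup.mk ψ : AzumayaDim.Out C B) ∣ Finset.univ.gcd d ∧
      (Finset.univ.gcd d = 1 → ∃ w : Bˣ, ∀ b : B, ψ b = w * b * (w⁻¹ : Bˣ)) := by
  obtain ⟨D, _, _, -, _, f, hf⟩ := hB
  exact mainTheorem6_general d (ι : (Fin k → ℂ) →+* B) f hf
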